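/- Let $K$ be a field and $S=K[x_i : i\in V]$ a polynomial ring in finitely many variables. For $F\subseteq V$ put $P_F=(x_i : i\in F)\subseteq S$; the ideals $P_F$ with $F\neq\emptyset$ are the nonzero monomial prime ideals of $S$. For an ideal $I\subseteq S$, an infinitesimal deformation of $S/I$ is a quotient $S[\epsilon]/J$, where $\epsilon^2=0$ and $J\subseteq S[\epsilon]$ is an ideal, such that the canonical homomorphism $K[\epsilon]\to S[\epsilon]/J$ is flat and the image of $J$ under $S[\epsilon]\to S[\epsilon]/(\epsilon)=S$ is $I$. It is trivial if some $K$-algebra automorphism of $S[\epsilon]$ maps $J$ onto $I\,S[\epsilon]$. The ideal $I$ is called rigid if every infinitesimal deformation of $S/I$ is trivial (equivalently, if the first cotangent functor $T^1(S/I)$ vanishes). (a) Let $A,F\subseteq V$ be disjoint, let $I\subseteq S$ be an ideal generated by squarefree monomials in the variables $x_i$, $i\in A$, and suppose that $P_F$ is not a principal ideal. Then $I\,P_F$ is rigid if and only if $I$ is rigid. (b) Let $t\ge 0$ and let $F_1,\dots,F_t\subseteq V$ be nonempty and pairwise disjoint. Then $\prod_{j=1}^t P_{F_j}$ is rigid if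 and only if at most one of the ideals $P_{F_1},\dots,P_{F_t}$ is principal. -/

import Mathlib

/-- The canonical homomorphism `K[ε] → S[ε]` of dual numbers, `a + b ε ↦ a + b ε`, for a
`K`-algebra `S`. -/
def dualNumberBaseChange (K S : Type*) [CommRing K] [CommRing S] [Algebra K S] :
    DualNumber K →+* DualNumber S where
  toFun z := TrivSqZeroExt.inl (algebraMap K S z.fst) + TrivSqZeroExt.inr (algebraMap K S z.snd)
  map_one' := by ext <;> simp
  map_mul' z w := by ext <;> simp [-DualNumber.inr_eq_smul_eps, mul_comm]
  map_zero' := by ext <;> simp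
  map_add' z w := by ext <;> simp [-DualNumber.inr_eq_smul_eps]

/-- `S[ε]/J` is an infinitesimal deformation of `S/I`: the canonical homomorphism
`K[ε] → S[ε]/J` is flat, and reduction of `S[ε]/J` modulo `ε` gives `S/I`, i.e. the image of `J`
under `S[ε] → S[ε]/(ε) = S` is `I`. -/
def IsInfinitesimalDeformation (K : Type*) {S : Type*} [CommRing K] [CommRing S] [Algebra K S]
    (I : Ideal S) (J : Ideal (DualNumber S)) : Prop :=
  RingHom.Flat (R := DualNumber K) (S := DualNumber S ⧸ J)
      ((Ideal.Quotient.mk J).comp (dualNumberBaseChange K S)) ∧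
    J.map (TrivSqZeroExt.fstHom S S S) = I

/-- The deformation `S[ε]/J` of `S/I` is trivial: some `K`-algebra automorphism of `S[ε]` maps
`J` to `I S[ε]`. -/
def IsTrivialDeformation (K : Type*) {S : Type*} [CommRing K] [CommRing S] [Algebra K S]
    (I : Ideal S) (J : Ideal (DualNumber S)) : Prop :=
  ∃ e : DualNumber S ≃ₐ[K] DualNumber S, J.map e = I.map (TrivSqZeroExt.inlHom S S)

/-- The ideal `I` (equivalently the `K`-algebra `S/I`) is rigid: `S/I` admits no non-trivial
infinitesimal deformation. -/
def IsRigidIdeal (K : Type*) {S : Type*} [CommRing K] [CommRing S] [Algebra K S]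
    (I : Ideal S) : Prop :=
  ∀ J : Ideal (DualNumber S), IsInfinitesimalDeformation K I J → IsTrivialDeformation K I J

/-- The ideal `P_F` generated by the variables `x_i`, `i ∈ F`. For `F` nonempty these are the
nonzero monomial prime ideals of the polynomial ring. -/
noncomputable def variableIdeal (K : Type*) {σ : Type*} [Field K] (F : Set σ) : Ideal (MvPolynomial σ K) :=
  Ideal.span (MvPolynomial.X '' F)

/-- `I` is a squarefree monomial ideal in the variables `x_i`, `i ∈ A`: it is generated by
monomials `x_N = ∏_{i ∈ N} x_i` with `N ⊆ A`. -/
def IsSquarefreeMonomialIdealIn {K σ : Type*} [Field K] (A : Set σ)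
    (I : Ideal (MvPolynomial σ K)) : Prop :=
  ∃ G : Set (Finset σ), (∀ N ∈ G, (N : Set σ) ⊆ A) ∧
    I = Ideal.span ((fun N : Finset σ => ∏ i ∈ N, MvPolynomial.X i) '' G)

/-! Flatness over `K[ε]` means that `ε g ∈ J` forces `g ∈ I`, so deformations of `S/I` correspond to
homomorphisms `φ : I → S/I`, and for a domain `S` the trivial ones are those induced by derivations
of `S`. Homomorphisms are encoded throughout by submodules `N ⊆ S × S`, the preimages of their
graphs, which avoids quotients.

For (a), let `I` be generated by polynomials in variables outside `F`. Then `I ∩ P_F = I P_F`, and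
distinct variables of `F` form a regular sequence modulo `I`. A homomorphism on `I` restricts to `I
P_F`, and cancelling one variable of `F` carries the resulting derivation back to `I`. Conversely,
given `φ : I P_F → S/(I P_F)`, two variables of `F` allow `φ` modulo `I` to be extended to `I → S/I`
(`exists_derivation_modulo`). Rigidity of `I` then yields a derivation, and subtracting it leaves a
homomorphism with values in `I/(I P_F)`. Modulo `P_F` the latter sends `f x_j` to `f q_j`, where the
fraction `q_j` stabilises `I` and is a polynomial by normality of `S`; so it is induced by the
derivation `x_j ↦ q_j` (`exists_derivation_of_image_le`).

For (b), part (a) removes the nonprincipal factors. What remains is a product of variables, and with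
at least two factors `f ↦ 1` is not induced by a derivation, because `f` and `D f` both vanish at
the origin. -/

open TrivSqZeroExt in
/-- Over the dual numbers `K[ε]` of a field, a homomorphism `g : K[ε] → M` is flat if and only if
the annihilator of `ε` in `M` is `ε M`. -/
theorem DualNumber.flat_iff {K M : Type*} [Field K] [CommRing M] (g : DualNumber K →+* M) :
    g.Flat ↔ ∀ m, g DualNumber.eps * m = 0 → ∃ m', m = g DualNumber.eps * m' := by
  let : Algebra (DualNumber K) M := g.toAlgebra
  have hsmul : ∀ (z : DualNumber K) (m : M), z • m = g z * m := fun z m => rfl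
  have hε : ∀ z : DualNumber K, z.fst = 0 → ∃ c, z = c * DualNumber.eps := by
    intro z hz
    refine ⟨inl z.snd, ?_⟩
    ext <;> simp [hz]
  constructor
  · intro h m hm
    have : Module.Flat (DualNumber K) M := h
    obtain ⟨k, a, y, hx, ha⟩ := Module.Flat.isTrivialRelation_of_sum_smul_eq_zero
      (R := DualNumber K) (f := fun _ : Fin 1 => DualNumber.eps) (x := fun _ => m)
      (by rw [Fin.sum_univ_one, hsmul, hm])
    have hb : ∀ j, ∃ c, a 0 j = c * DualNumber.eps := by
      intro j
      apply hε
      have h0 := congrArg snd (ha j)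
      rw [Fin.sum_univ_one] at h0
      simpa using h0
    choose b hb using hb
    refine ⟨∑ j, g (b j) * y j, ?_⟩
    rw [Finset.mul_sum, show m = _ from hx 0]
    refine Finset.sum_congr rfl fun j _ => ?_
    rw [hsmul, hb, map_mul]
    ring
  · intro h
    change Module.Flat (DualNumber K) M
    rw [Module.Flat.iff_lift_lsmul_comp_subtype_injective]
    intro I _
    -- If `e` generates the ideal, every tensor is pure of the form `e ⊗ m`. The ideals of `K[ε]`
    -- are `(1)`, `(ε)` and `0`, so this covers all cases.
    have key : ∀ (e : DualNumber K) (he : e ∈ I), (∀ z ∈ I, ∃ c, z = c * e) →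
        ∀ t : TensorProduct (DualNumber K) I M, ∃ m : M, t = (⟨e, he⟩ : I) ⊗ₜ[DualNumber K] m := by
      intro e he hz t
      induction t using TensorProduct.induction_on with
      | zero => exact ⟨0, by simp⟩
      | tmul z m =>
        obtain ⟨c, hc⟩ := hz z z.2
        refine ⟨c • m, ?_⟩
        have hzc : z = c • (⟨e, he⟩ : I) := Subtype.ext hc
        rw [hzc]
        exact TensorProduct.smul_tmul c _ m
      | add s t hs ht =>
        obtain ⟨m, rfl⟩ := hs
        obtain ⟨n, rfl⟩ := ht
        exact ⟨m + n, (TensorProduct.tmul_add _ _ _).symm⟩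
    rw [injective_iff_map_eq_zero]
    intro t ht
    by_cases h1 : ∃ z ∈ I, z.fst ≠ 0
    · obtain ⟨z, hz, hz1⟩ := h1
      have hu : IsUnit z := TrivSqZeroExt.isUnit_iff_isUnit_fst.2 (isUnit_iff_ne_zero.2 hz1)
      have h1I : (1 : DualNumber K) ∈ I := by
        rw [I.eq_top_of_isUnit_mem hz hu]; trivial
      obtain ⟨m, rfl⟩ := key 1 h1I (fun z _ => ⟨z, (mul_one z).symm⟩) t
      have : m = 0 := by simpa [hsmul] using ht
      rw [this, TensorProduct.tmul_zero]
    · push Not at h1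
      by_cases h2 : DualNumber.eps ∈ I
      · obtain ⟨m, rfl⟩ := key _ h2 (fun z hz => hε z (h1 z hz)) t
        obtain ⟨m', rfl⟩ := h m (by simpa [hsmul] using ht)
        have h3 : (DualNumber.eps : DualNumber K) • (⟨DualNumber.eps, h2⟩ : I) = 0 :=
          Subtype.ext (by simp)
        refine (TensorProduct.smul_tmul (DualNumber.eps : DualNumber K) (⟨DualNumber.eps, h2⟩ : I) m').symm.trans ?_
        rw [h3, TensorProduct.zero_tmul]
      · have h3 : ∀ z ∈ I, z = 0 := by
          intro z hz
          by_contra hne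
          obtain ⟨c, rfl⟩ := hε z (h1 z hz)
          have hc : c.fst ≠ 0 := by
            intro hc
            obtain ⟨d, rfl⟩ := hε c hc
            exact hne (by rw [mul_assoc, DualNumber.eps_mul_eps, mul_zero])
          have hu : IsUnit c := TrivSqZeroExt.isUnit_iff_isUnit_fst.2 (isUnit_iff_ne_zero.2 hc)
          exact h2 ((I.unit_mul_mem_iff_mem hu).1 hz)
        obtain ⟨m, rfl⟩ := key 0 I.zero_mem (fun z hz => ⟨0, by rw [h3 z hz, mul_zero]⟩) t
        exact TensorProduct.zero_tmul _ _

/-! ### Deformations, homomorphisms and derivations -/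

section Deformations

open TrivSqZeroExt

variable {K S : Type*} [Field K] [CommRing S] [Algebra K S]

theorem dualNumberBaseChange_eps :
    dualNumberBaseChange K S DualNumber.eps = DualNumber.eps := by
  ext <;> simp [dualNumberBaseChange]

theorem Ideal.mem_map_fstHom {J : Ideal (DualNumber S)} {f : S} :
    f ∈ J.map (fstHom S S S) ↔ ∃ g, inl f + inr g ∈ J := by
  have hs : Function.Surjective (fstHom S S S) := fun s => ⟨inl s, by simp⟩
  rw [Ideal.mem_map_iff_of_surjective _ hs]
  constructor
  · rintro ⟨z, hz, rfl⟩
    exact ⟨z.snd, by simpa only [fstHom_apply, inl_fst_add_inr_snd_eq] using hz⟩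
  · rintro ⟨g, hg⟩
    exact ⟨_, hg, by simp⟩

theorem Ideal.mem_map_inlHom {I : Ideal S} {z : DualNumber S} :
    z ∈ I.map (inlHom S S) ↔ z.fst ∈ I ∧ z.snd ∈ I := by
  constructor
  · intro hz
    refine Submodule.span_induction ?_ ?_ ?_ ?_ hz
    · rintro _ ⟨f, hf, rfl⟩
      simpa using hf
    · simp
    · rintro x y - - ⟨h1, h2⟩ ⟨h3, h4⟩
      exact ⟨by simpa using I.add_mem h1 h3, by simpa using I.add_mem h2 h4⟩
    · rintro a x - ⟨h1, h2⟩
      refine ⟨by simpa using I.mul_mem_left _ h1, ?_⟩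
      have := I.add_mem (I.mul_mem_left a.fst h2) (I.mul_mem_left a.snd h1)
      simpa [mul_comm] using this
  · rintro ⟨h1, h2⟩
    have : z = inlHom S S z.fst + DualNumber.eps * inlHom S S z.snd := by
      ext <;> simp
    rw [this]
    exact Ideal.add_mem _ (Ideal.mem_map_of_mem _ h1)
      (Ideal.mul_mem_left _ _ (Ideal.mem_map_of_mem _ h2))

theorem inr_mem_of_fst_mem {J : Ideal (DualNumber S)} {f g : S} (h : inl f + inr g ∈ J) :
    inr f ∈ J := by
  have := J.mul_mem_left DualNumber.eps h
  convert this using 1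
  ext <;> simp

/-- Infinitesimal deformations of `S/I` are the ideals `J ⊆ S[ε]` with image `I` such that
`ε g ∈ J` forces `g ∈ I`. -/
theorem isInfinitesimalDeformation_iff {I : Ideal S} {J : Ideal (DualNumber S)} :
    IsInfinitesimalDeformation K I J ↔
      (∀ f, f ∈ I ↔ ∃ g, inl f + inr g ∈ J) ∧ ∀ g : S, inr g ∈ J → g ∈ I := by
  rw [IsInfinitesimalDeformation, DualNumber.flat_iff]
  have h2 : J.map (fstHom S S S) = I ↔ ∀ f, f ∈ I ↔ ∃ g, inl f + inr g ∈ J := by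
    simp only [← Ideal.mem_map_fstHom, SetLike.ext_iff]
    exact forall_congr' fun _ => Iff.comm
  rw [h2, and_comm]
  refine and_congr_right fun hI => ?_
  simp only [RingHom.comp_apply, dualNumberBaseChange_eps]
  have hmul : ∀ z : DualNumber S, DualNumber.eps * z = inr z.fst := by
    intro z
    ext <;> simp
  constructor
  · intro h g hg
    obtain ⟨m', hm'⟩ := h (Ideal.Quotient.mk J (inl g)) (by
      rw [← map_mul, hmul, fst_inl, Ideal.Quotient.eq_zero_iff_mem]
      exact hg)
    obtain ⟨z, rfl⟩ := Ideal.Quotient.mk_surjective m'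
    rw [← map_mul, hmul, Ideal.Quotient.eq] at hm'
    refine (hI g).2 ⟨-z.fst, ?_⟩
    rwa [inr_neg, ← sub_eq_add_neg]
  · intro h m hm
    obtain ⟨z, rfl⟩ := Ideal.Quotient.mk_surjective m
    rw [← map_mul, hmul, Ideal.Quotient.eq_zero_iff_mem] at hm
    obtain ⟨g, hg⟩ := (hI _).1 (h _ hm)
    refine ⟨Ideal.Quotient.mk J (inl (z.snd - g)), ?_⟩
    rw [← map_mul, hmul, fst_inl, Ideal.Quotient.eq]
    convert hg using 1
    ext <;> simp

/-- The `K`-algebra automorphism `s + ε t ↦ s + ε (t + D s)` of `S[ε]` defined by a derivation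
`D` of `S`. -/
def DualNumber.expDerivation (D : Derivation K S S) : DualNumber S ≃ₐ[K] DualNumber S where
  toFun z := inl z.fst + inr (z.snd + D z.fst)
  invFun z := inl z.fst + inr (z.snd - D z.fst)
  left_inv z := by ext <;> simp
  right_inv z := by ext <;> simp
  map_mul' x y := by
    ext
    · simp
    · simp
      ring
  map_add' x y := by
    ext
    · simp
    · simp
      ring
  commutes' r := by ext <;> simp [TrivSqZeroExt.algebraMap_eq_inl']

/-- In a domain the elements of square zero in `S[ε]` are exactly those of `ε S`, so `e` preserves
`ε S` and has the form `f + ε g ↦ a f + ε (d f + u (a g))` with `a` an automorphism of `S` and `u` a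
unit. The derivation is `-a⁻¹ (u⁻¹ d)`. -/
theorem exists_derivation_of_map_eq [IsDomain S] {I : Ideal S} {J : Ideal (DualNumber S)}
    (e : DualNumber S ≃ₐ[K] DualNumber S) (he : J.map e = I.map (inlHom S S))
    (hI : ∀ f, f ∈ I ↔ ∃ g, inl f + inr g ∈ J) :
    ∃ D : Derivation K S S, ∀ f g : S, inl f + inr g ∈ J → g - D f ∈ I := by
  have nil : ∀ z : DualNumber S, z * z = 0 ↔ z.fst = 0 := by
    intro z
    constructor
    · intro h
      have := congrArg fst h
      simpa using this
    · intro h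
      ext <;> simp [h]
  have hfst : ∀ z, (e z).fst = 0 ↔ z.fst = 0 := by
    intro z
    rw [← nil, ← nil, ← map_mul, EmbeddingLike.map_eq_zero_iff]
  have hJ : ∀ z, z ∈ J ↔ (e z).fst ∈ I ∧ (e z).snd ∈ I := by
    intro z
    rw [← Ideal.mem_map_inlHom, ← he]
    exact (Ideal.mem_map_of_equiv e (e z)).trans
      ⟨fun ⟨x, hx, h⟩ => e.injective h ▸ hx, fun h => ⟨z, h, rfl⟩⟩ |>.symm
  let a0 : S →ₐ[K] S := ((fstHom K S S).comp (e : DualNumber S →ₐ[K] DualNumber S)).comp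
    (inlAlgHom K S S)
  have ha0 : ∀ s, a0 s = (e (inl s)).fst := fun s => rfl
  have hdec : ∀ f g : S, inl f + inr g = inl f + DualNumber.eps * (inl g : DualNumber S) := by
    intro f g
    ext <;> simp
  have hε : (e DualNumber.eps).fst = 0 := (hfst _).2 (by simp)
  have hefst : ∀ f g : S, (e (inl f + inr g)).fst = a0 f := by
    intro f g
    rw [hdec, map_add, map_mul, fst_add, fst_mul, hε, zero_mul, add_zero, ha0]
  set u : S := (e DualNumber.eps).snd with hu
  have hesnd : ∀ f g : S, (e (inl f + inr g)).snd = (e (inl f)).snd + u * a0 g := by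
    intro f g
    rw [hdec, map_add, map_mul, snd_add, snd_mul, hε, ha0]
    simp [hu, mul_comm]
  have hinj : Function.Injective a0 := by
    rw [injective_iff_map_eq_zero]
    intro s hs
    simpa using (hfst (inl s)).1 hs
  have hsurj : Function.Surjective a0 := by
    intro s
    obtain ⟨z, hz⟩ := e.surjective (inl s)
    refine ⟨z.fst, ?_⟩
    rw [← hefst z.fst z.snd, inl_fst_add_inr_snd_eq, hz, fst_inl]
  let a : S ≃ₐ[K] S := AlgEquiv.ofBijective a0 ⟨hinj, hsurj⟩
  obtain ⟨v, hv⟩ : ∃ v, u * v = 1 := by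
    obtain ⟨z, hz⟩ := e.surjective DualNumber.eps
    have hz0 : z.fst = 0 := (hfst z).1 (by rw [hz]; simp)
    refine ⟨a0 z.snd, ?_⟩
    have := hesnd z.fst z.snd
    rw [inl_fst_add_inr_snd_eq, hz, hz0, inl_zero, map_zero, snd_zero, zero_add] at this
    simpa using this.symm
  -- Reducing `e` modulo `ε` shows that `a` reflects membership in `I`, so the final congruence may
  -- be checked after applying `a`.
  have haI : ∀ s, a0 s ∈ I → s ∈ I := by
    intro s hs
    have : (inl (a0 s) : DualNumber S) ∈ I.map (inlHom S S) := by
      rw [Ideal.mem_map_inlHom]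
      simpa using hs
    obtain ⟨z, hz⟩ := e.surjective (inl (a0 s))
    have hzJ : z ∈ J := by
      rw [hJ, hz, ← Ideal.mem_map_inlHom]
      exact this
    have : z.fst = s := by
      apply hinj
      rw [← hefst z.fst z.snd, inl_fst_add_inr_snd_eq, hz, fst_inl]
    rw [← this, hI]
    exact ⟨z.snd, by rwa [inl_fst_add_inr_snd_eq]⟩
  have hd : ∀ s t : S, (e (inl (s * t))).snd = a0 s * (e (inl t)).snd + a0 t * (e (inl s)).snd := by
    intro s t
    rw [inl_mul, map_mul, snd_mul, ha0, ha0, op_smul_eq_smul, smul_eq_mul, smul_eq_mul]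
  let dl : S →ₗ[K] S := -(a.symm.toLinearMap ∘ₗ LinearMap.mulLeft K v ∘ₗ
    ((sndHom S S).restrictScalars K) ∘ₗ e.toLinearMap ∘ₗ (inlAlgHom K S S).toLinearMap)
  have hdl : ∀ s, dl s = -a.symm (v * (e (inl s)).snd) := fun s => rfl
  have has : ∀ s, a.symm (a0 s) = s := fun s => a.symm_apply_apply s
  refine ⟨Derivation.mk' dl ?_, ?_⟩
  · intro s t
    simp only [hdl, hd, mul_add, map_add, map_mul, has, smul_eq_mul]
    ring
  · intro f g hfg
    apply haI
    rw [Derivation.coe_mk', hdl, map_sub, map_neg, sub_neg_eq_add]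
    have h1 : a0 (a.symm (v * (e (inl f)).snd)) = v * (e (inl f)).snd := a.apply_symm_apply _
    have h2 := ((hJ _).1 hfg).2
    rw [hesnd] at h2
    rw [h1]
    convert I.mul_mem_left v h2 using 1
    linear_combination (-a0 g) * hv

/-- Let `I` be a rigid ideal of a domain `S`. If `N ⊆ S × S` is a submodule inducing a
homomorphism `I → S/I`, then this homomorphism is induced by a derivation of `S`. -/
theorem IsRigidIdeal.exists_derivation [IsDomain S] {I : Ideal S} (h : IsRigidIdeal K I)
    (N : Submodule S (S × S)) (hN : ∀ f ∈ I, ∃ g, (f, g) ∈ N) (hN0 : ∀ g, (0, g) ∈ N → g ∈ I) :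
    ∃ D : Derivation K S S, ∀ f ∈ I, ∀ g, (f, g) ∈ N → g - D f ∈ I := by
  -- The deformation attached to `φ`: all `f + ε g` with `f ∈ I` and `g` representing `φ f` modulo
  -- `I`.
  let J : Ideal (DualNumber S) :=
    { carrier := {z | z.fst ∈ I ∧ ∃ g, (z.fst, g) ∈ N ∧ z.snd - g ∈ I}
      zero_mem' := ⟨I.zero_mem, 0, N.zero_mem, by simp⟩
      add_mem' := by
        rintro x y ⟨hx, g, hg, hxg⟩ ⟨hy, g', hg', hyg⟩
        refine ⟨I.add_mem hx hy, g + g', N.add_mem hg hg', ?_⟩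
        convert I.add_mem hxg hyg using 1
        rw [snd_add]
        ring
      smul_mem' := by
        rintro c x ⟨hx, g, hg, hxg⟩
        refine ⟨I.mul_mem_left c.fst hx, c.fst * g, N.smul_mem c.fst hg, ?_⟩
        convert I.add_mem (I.mul_mem_left c.fst hxg) (I.mul_mem_left c.snd hx) using 1
        rw [smul_eq_mul, snd_mul, op_smul_eq_smul, smul_eq_mul, smul_eq_mul]
        ring }
  have hJ : ∀ f g : S, inl f + inr g ∈ J ↔ f ∈ I ∧ ∃ g', (f, g') ∈ N ∧ g - g' ∈ I := by
    intro f g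
    change (inl f + inr g : DualNumber S).fst ∈ I ∧ (∃ g', ((inl f + inr g : DualNumber S).fst, g')
      ∈ N ∧ (inl f + inr g : DualNumber S).snd - g' ∈ I) ↔ _
    simp
  have hdef : IsInfinitesimalDeformation K I J := by
    rw [isInfinitesimalDeformation_iff]
    constructor
    · intro f
      constructor
      · intro hf
        obtain ⟨g, hg⟩ := hN f hf
        exact ⟨g, (hJ f g).2 ⟨hf, g, hg, by simp⟩⟩
      · rintro ⟨g, hg⟩
        exact ((hJ f g).1 hg).1
    · intro g hg
      rw [← zero_add (inr g), ← inl_zero S] at hg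
      obtain ⟨-, g', h0, h1⟩ := (hJ 0 g).1 hg
      exact (I.sub_mem_iff_left (hN0 g' h0)).1 h1
  obtain ⟨e, he⟩ := h J hdef
  obtain ⟨D, hD⟩ := exists_derivation_of_map_eq e he (isInfinitesimalDeformation_iff.1 hdef).1
  exact ⟨D, fun f hf g hg => hD f g ((hJ f g).2 ⟨hf, g, hg, by simp⟩)⟩

/-- An ideal `I` is rigid if all homomorphisms `I → S/I`, given by their preimages in `S × S`, are
induced by derivations of `S`. -/
theorem isRigidIdeal_of_exists_derivation {I : Ideal S}
    (h : ∀ N : Submodule S (S × S), (∀ f ∈ I, ∃ g, (f, g) ∈ N) → (∀ g, (0, g) ∈ N → g ∈ I) →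
      ∃ D : Derivation K S S, ∀ f ∈ I, ∀ g, (f, g) ∈ N → g - D f ∈ I) :
    IsRigidIdeal K I := by
  intro J hJ
  obtain ⟨hI, hε⟩ := isInfinitesimalDeformation_iff.1 hJ
  let N : Submodule S (S × S) :=
    { carrier := {p | inl p.1 + inr p.2 ∈ J}
      zero_mem' := by simp
      add_mem' := by
        intro x y hx hy
        have : (inl (x + y).1 + inr (x + y).2 : DualNumber S) =
            inl x.1 + inr x.2 + (inl y.1 + inr y.2) := by ext <;> simp
        change inl (x + y).1 + inr (x + y).2 ∈ J
        rw [this]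
        exact J.add_mem hx hy
      smul_mem' := by
        intro c x hx
        have : (inl (c • x).1 + inr (c • x).2 : DualNumber S) = inl c * (inl x.1 + inr x.2) := by
          ext <;> simp
        change inl (c • x).1 + inr (c • x).2 ∈ J
        rw [this]
        exact J.mul_mem_left (inl c) hx }
  obtain ⟨D, hD⟩ := h N (fun f hf => (hI f).1 hf) fun g hg => hε g (by
    have hg' : (inl 0 + inr g : DualNumber S) ∈ J := hg
    simpa using hg')
  have hinr : ∀ g ∈ I, inr g ∈ J := fun g hg => inr_mem_of_fst_mem ((hI g).1 hg).choose_spec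
  -- The sign makes the automorphism subtract `D f` from the `ε`-part, which moves that part into
  -- `I`.
  refine ⟨DualNumber.expDerivation (-D), ?_⟩
  ext z
  rw [Ideal.mem_map_inlHom]
  have hcrit : ∀ x, DualNumber.expDerivation (-D) x = inl x.fst + inr (x.snd - D x.fst) := by
    intro x
    simp [DualNumber.expDerivation, sub_eq_add_neg]
  refine (Ideal.mem_map_of_equiv _ z).trans ?_
  constructor
  · rintro ⟨x, hx, rfl⟩
    rw [← inl_fst_add_inr_snd_eq x] at hx
    have hxI : x.fst ∈ I := (hI _).2 ⟨_, hx⟩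
    rw [hcrit]
    simpa [hxI] using hD _ hxI x.snd hx
  · rintro ⟨h1, h2⟩
    refine ⟨inl z.fst + inr (z.snd + D z.fst), ?_, ?_⟩
    · obtain ⟨g, hg⟩ := (hI _).1 h1
      convert J.add_mem hg (hinr _ (I.sub_mem h2 (hD _ h1 g hg))) using 1
      ext
      · simp
      · simp
        ring
    · rw [hcrit]
      ext <;> simp

end Deformations

/-! ### Tools: checking on generators, and divisibility by normality -/

/-- To verify that a derivation induces the homomorphism `L → S/I` given by `N`, it suffices to
do so on generators of `L`. -/
theorem Derivation.sub_mem_of_mem_span {K S : Type*} [CommRing K] [CommRing S] [Algebra K S]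
    {I L : Ideal S} (hL : L ≤ I) {T : Set S} (hT : L = Ideal.span T) (N : Submodule S (S × S))
    (hN0 : ∀ g, (0, g) ∈ N → g ∈ I) (D : Derivation K S S)
    (h : ∀ t ∈ T, ∃ g, (t, g) ∈ N ∧ g - D t ∈ I) :
    ∀ f ∈ L, ∀ g, (f, g) ∈ N → g - D f ∈ I := by
  have key : ∀ f ∈ Ideal.span T, f ∈ L ∧ ∃ g, (f, g) ∈ N ∧ g - D f ∈ I := by
    intro f hf
    refine Submodule.span_induction ?_ ?_ ?_ ?_ hf
    · intro t ht
      exact ⟨hT ▸ Ideal.subset_span ht, h t ht⟩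
    · exact ⟨L.zero_mem, 0, N.zero_mem, by simp⟩
    · rintro x y - - ⟨hx, g, hg, hxg⟩ ⟨hy, g', hg', hyg⟩
      refine ⟨L.add_mem hx hy, g + g', N.add_mem hg hg', ?_⟩
      rw [map_add, add_sub_add_comm]
      exact I.add_mem hxg hyg
    · rintro c x - ⟨hx, g, hg, hxg⟩
      refine ⟨L.mul_mem_left c hx, c * g, N.smul_mem c hg, ?_⟩
      have : c * g - D (c • x) = c * (g - D x) - D c * x := by
        rw [smul_eq_mul, D.leibniz, smul_eq_mul, smul_eq_mul]
        ring
      rw [this]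
      exact I.sub_mem (I.mul_mem_left _ hxg) (I.mul_mem_left _ (hL hx))
  intro f hf g hg
  obtain ⟨-, g', hg', h1⟩ := key f (hT ▸ hf)
  have h2 := hN0 (g - g') (by simpa using N.sub_mem hg hg')
  simpa using I.add_mem h2 h1

/-- In an integrally closed Noetherian domain, `a ∣ v` as soon as `v / a` maps some nonzero ideal
to itself. -/
theorem dvd_of_forall_mem_ideal {S : Type*} [CommRing S] [IsDomain S] [IsNoetherianRing S]
    [IsIntegrallyClosed S] {I : Ideal S} (hI : I ≠ ⊥) {a v : S} (ha : a ≠ 0)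
    (h : ∀ f ∈ I, ∃ w ∈ I, a * w = f * v) : a ∣ v := by
  let L := FractionRing S
  have ha' : algebraMap S L a ≠ 0 := by simpa using ha
  -- The fraction `v / a` stabilises a nonzero finitely generated submodule of the fraction field,
  -- so it is integral by the determinant trick.
  have hint : IsIntegral S (algebraMap S L v / algebraMap S L a) := by
    refine isIntegral_of_smul_mem_submodule (M := L)
      (Submodule.map (Algebra.linearMap S L) I) ?_ ?_ _ ?_
    · obtain ⟨f, hf, hf0⟩ := Submodule.exists_mem_ne_zero_of_ne_bot hI
      rw [Submodule.ne_bot_iff]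
      exact ⟨algebraMap S L f, ⟨f, hf, rfl⟩, by simpa using hf0⟩
    · exact Submodule.FG.map (Algebra.linearMap S L)
        ((isNoetherianRing_iff_ideal_fg S).1 inferInstance I)
    · rintro _ ⟨f, hf, rfl⟩
      obtain ⟨w, hw, hw'⟩ := h f hf
      refine ⟨w, hw, ?_⟩
      simp only [Algebra.linearMap_apply, smul_eq_mul]
      rw [div_mul_eq_mul_div, eq_div_iff ha', ← map_mul, ← map_mul, mul_comm w, hw', mul_comm]
  obtain ⟨y, hy⟩ := IsIntegrallyClosed.isIntegral_iff.1 hint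
  refine ⟨y, IsFractionRing.injective S L ?_⟩
  rw [map_mul, hy, mul_div_cancel₀ _ ha']

theorem Submodule.mul_mul_mem {S : Type*} [CommRing S] (N : Submodule S (S × S)) {f g : S} (c : S)
    (h : (f, g) ∈ N) : (c * f, c * g) ∈ N :=
  N.smul_mem c h

theorem Submodule.sub_sub_mem {S : Type*} [CommRing S] (N : Submodule S (S × S)) {f g f' g' : S}
    (h : (f, g) ∈ N) (h' : (f', g') ∈ N) : (f - f', g - g') ∈ N :=
  N.sub_mem h h'

/-! ### Ideals generated in variables outside `F`, and part (a) -/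

namespace MvPolynomial

variable {K σ : Type*} [Field K]

open Classical in
/-- The `K`-algebra endomorphism of the polynomial ring that sets the variables in `F` to zero. -/
noncomputable def zeroVars (K : Type*) {σ : Type*} [Field K] (F : Set σ) :
    MvPolynomial σ K →ₐ[K] MvPolynomial σ K :=
  aeval fun i => if i ∈ F then 0 else X i

theorem zeroVars_X_of_mem {F : Set σ} {i : σ} (hi : i ∈ F) : zeroVars K F (X i) = 0 := by
  simp [zeroVars, hi]

theorem zeroVars_X_of_notMem {F : Set σ} {i : σ} (hi : i ∉ F) : zeroVars K F (X i) = X i := by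
  simp [zeroVars, hi]

theorem zeroVars_of_mem_supported {A F : Set σ} (hAF : Disjoint A F) {f : MvPolynomial σ K}
    (hf : f ∈ supported K A) : zeroVars K F f = f := by
  have h : supported K A ≤ AlgHom.equalizer (zeroVars K F) (AlgHom.id K _) := by
    rw [supported_eq_adjoin_X]
    refine Algebra.adjoin_le ?_
    rintro _ ⟨i, hi, rfl⟩
    exact zeroVars_X_of_notMem (hAF.notMem_of_mem_left hi)
  exact h hf

theorem X_mem_variableIdeal {F : Set σ} {i : σ} (hi : i ∈ F) : X i ∈ variableIdeal K F :=
  Ideal.subset_span ⟨i, hi, rfl⟩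

theorem zeroVars_of_mem_variableIdeal {F : Set σ} {f : MvPolynomial σ K}
    (hf : f ∈ variableIdeal K F) : zeroVars K F f = 0 := by
  have h : variableIdeal K F ≤ RingHom.ker (zeroVars K F) := by
    rw [variableIdeal, Ideal.span_le]
    rintro _ ⟨i, hi, rfl⟩
    exact zeroVars_X_of_mem hi
  exact h hf

theorem sub_zeroVars_mem (F : Set σ) (f : MvPolynomial σ K) :
    f - zeroVars K F f ∈ variableIdeal K F := by
  induction f using MvPolynomial.induction_on with
  | C a => simp [zeroVars]
  | add p q hp hq =>
    rw [map_add, add_sub_add_comm]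
    exact Ideal.add_mem _ hp hq
  | mul_X p i hp =>
    by_cases hi : i ∈ F
    · rw [map_mul, zeroVars_X_of_mem hi, mul_zero, sub_zero]
      exact Ideal.mul_mem_left _ _ (X_mem_variableIdeal hi)
    · rw [map_mul, zeroVars_X_of_notMem hi, ← sub_mul]
      exact Ideal.mul_mem_right _ _ hp

theorem mem_variableIdeal_iff {F : Set σ} {f : MvPolynomial σ K} :
    f ∈ variableIdeal K F ↔ zeroVars K F f = 0 :=
  ⟨zeroVars_of_mem_variableIdeal, fun h => by simpa [h] using sub_zeroVars_mem F f⟩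

theorem zeroVars_zeroVars (F : Set σ) (f : MvPolynomial σ K) :
    zeroVars K F (zeroVars K F f) = zeroVars K F f := by
  have := zeroVars_of_mem_variableIdeal (sub_zeroVars_mem F f)
  rw [map_sub, sub_eq_zero] at this
  exact this.symm

/-- The ideal `I` is generated by polynomials in the variables `x_i`, `i ∈ A`. -/
def IsGeneratedIn (A : Set σ) (I : Ideal (MvPolynomial σ K)) : Prop :=
  ∃ G : Set (MvPolynomial σ K), G ⊆ supported K A ∧ I = Ideal.span G

open scoped Pointwise

namespace IsGeneratedIn

variable {A F : Set σ} {I : Ideal (MvPolynomial σ K)}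

/-- Generators of `I` do not involve `F` and are fixed by `zeroVars`; multiples follow by splitting
the difference of products. This is the source of `I ∩ P_F = I P_F`. -/
theorem sub_zeroVars_mem_mul (hI : IsGeneratedIn A I) (hAF : Disjoint A F) {f : MvPolynomial σ K}
    (hf : f ∈ I) : f - zeroVars K F f ∈ I * variableIdeal K F := by
  obtain ⟨G, hG, rfl⟩ := hI
  refine Submodule.span_induction ?_ ?_ ?_ ?_ hf
  · intro g hg
    rw [zeroVars_of_mem_supported hAF (hG hg), sub_self]
    exact Ideal.zero_mem _
  · simp
  · intro x y _ _ hx hy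
    rw [map_add, add_sub_add_comm]
    exact Ideal.add_mem _ hx hy
  · intro c x hx h
    have : c • x - zeroVars K F (c • x) = zeroVars K F c * (x - zeroVars K F x) +
        x * (c - zeroVars K F c) := by
      rw [smul_eq_mul, map_mul]
      ring
    rw [this]
    exact Ideal.add_mem _ (Ideal.mul_mem_left _ _ h) (Ideal.mul_mem_mul hx (sub_zeroVars_mem F c))

theorem zeroVars_mem (hI : IsGeneratedIn A I) (hAF : Disjoint A F) {f : MvPolynomial σ K}
    (hf : f ∈ I) : zeroVars K F f ∈ I := by
  have := I.sub_mem hf (Ideal.mul_le_left (hI.sub_zeroVars_mem_mul hAF hf))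
  simpa using this

theorem mem_mul_variableIdeal (hI : IsGeneratedIn A I) (hAF : Disjoint A F) {f : MvPolynomial σ K}
    (hf : f ∈ I) (hfF : f ∈ variableIdeal K F) : f ∈ I * variableIdeal K F := by
  simpa [mem_variableIdeal_iff.1 hfF] using hI.sub_zeroVars_mem_mul hAF hf

/-- Here `x_i f` lies in `I ∩ (x_i) = I (x_i)`, and `x_i` cancels. -/
theorem mem_of_X_mul_mem (hI : IsGeneratedIn A I) {i : σ} (hi : i ∉ A) {f : MvPolynomial σ K}
    (hf : X i * f ∈ I) : f ∈ I := by
  have h := hI.mem_mul_variableIdeal (F := {i}) (Set.disjoint_singleton_right.2 hi) hf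
    (Ideal.mul_mem_right _ _ (X_mem_variableIdeal rfl))
  rw [variableIdeal, Set.image_singleton, mul_comm, Ideal.mem_span_singleton_mul] at h
  obtain ⟨g, hg, hgf⟩ := h
  rwa [← mul_left_cancel₀ (X_ne_zero i) hgf]

/-- The pair `x_j, x_i` behaves as a regular sequence modulo `I`: setting `x_j = 0` leaves `x_i`
times the reduction of `f` in `I`, and `x_i` cancels. -/
theorem exists_sub_mul_mem (hI : IsGeneratedIn A I) {i j : σ} (hi : i ∉ A) (hj : j ∉ A)
    (hij : i ≠ j) {f g : MvPolynomial σ K} (h : X i * f - X j * g ∈ I) :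
    ∃ w, f - X j * w ∈ I := by
  have h1 := hI.zeroVars_mem (F := {j}) (Set.disjoint_singleton_right.2 hj) h
  rw [map_sub, map_mul, map_mul, zeroVars_X_of_mem (Set.mem_singleton j),
    zeroVars_X_of_notMem (by simpa using hij), zero_mul, sub_zero] at h1
  have h2 := hI.mem_of_X_mul_mem hi h1
  have h3 := sub_zeroVars_mem {j} f
  rw [variableIdeal, Set.image_singleton, Ideal.mem_span_singleton] at h3
  obtain ⟨w, hw⟩ := h3
  refine ⟨w, ?_⟩
  rw [← hw, sub_sub_cancel]
  exact h2

theorem isRigidIdeal_of_mul (hI : IsGeneratedIn A I) (hAF : Disjoint A F) (hF : F.Nonempty)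
    (h : IsRigidIdeal K (I * variableIdeal K F)) : IsRigidIdeal K I := by
  obtain ⟨i, hi⟩ := hF
  refine isRigidIdeal_of_exists_derivation fun N hN hN0 => ?_
  -- Values are restricted to `P_F`, so that the ambiguity of a value drops from `I` to `I ∩ P_F = I
  -- P_F`.
  let M := N ⊓ Submodule.comap (LinearMap.snd _ _ _) (variableIdeal K F)
  have hM : ∀ f g, (f, g) ∈ M ↔ (f, g) ∈ N ∧ g ∈ variableIdeal K F := fun f g => Iff.rfl
  have hMex : ∀ f ∈ I * variableIdeal K F, ∃ g, (f, g) ∈ M := by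
    intro f hf
    refine Submodule.mul_induction_on hf ?_ ?_
    · intro f hf p hp
      obtain ⟨g, hg⟩ := hN f hf
      refine ⟨p * g, (hM _ _).2 ⟨?_, Ideal.mul_mem_right _ _ hp⟩⟩
      rw [mul_comm f p]
      exact N.mul_mul_mem p hg
    · rintro x y ⟨g, hg⟩ ⟨g', hg'⟩
      exact ⟨g + g', M.add_mem hg hg'⟩
  obtain ⟨D, hD⟩ := h.exists_derivation M hMex fun g hg =>
    hI.mem_mul_variableIdeal hAF (hN0 g hg.1) hg.2
  refine ⟨D, fun f hf g hg => ?_⟩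
  apply hI.mem_of_X_mul_mem (hAF.notMem_of_mem_right hi)
  have h1 := Ideal.mul_le_left (hD (X i * f)
    (mul_comm f (X i) ▸ Ideal.mul_mem_mul hf (X_mem_variableIdeal hi)) (X i * g)
    ((hM _ _).2 ⟨N.mul_mul_mem (X i) hg, Ideal.mul_mem_right _ _ (X_mem_variableIdeal hi)⟩))
  convert I.add_mem h1 (I.mul_mem_left (D (X i)) hf) using 1
  rw [D.leibniz, smul_eq_mul, smul_eq_mul]
  ring

/-- A homomorphism `I P_F → S/(I P_F)` with image in `I/(I P_F)` is induced by a derivation. -/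
theorem exists_derivation_of_image_le [Finite σ] (hI : IsGeneratedIn A I) (hAF : Disjoint A F)
    (N : Submodule (MvPolynomial σ K) (MvPolynomial σ K × MvPolynomial σ K))
    (hN : ∀ f ∈ I * variableIdeal K F, ∃ g, (f, g) ∈ N)
    (hN0 : ∀ g, (0, g) ∈ N → g ∈ I * variableIdeal K F)
    (hNI : ∀ f ∈ I * variableIdeal K F, ∀ g, (f, g) ∈ N → g ∈ I) :
    ∃ D : Derivation K (MvPolynomial σ K) (MvPolynomial σ K),
      ∀ f ∈ I * variableIdeal K F, ∀ g, (f, g) ∈ N → g - D f ∈ I * variableIdeal K F := by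
  classical
  obtain ⟨G, hG, hIG⟩ := id hI
  have hGI : ∀ f ∈ G, f ∈ I := fun f hf => hIG ▸ Ideal.subset_span hf
  have hGF : ∀ f ∈ G, zeroVars K F f = f := fun f hf => zeroVars_of_mem_supported hAF (hG hf)
  have hLspan : I * variableIdeal K F =
      Ideal.span (G * (X '' F : Set (MvPolynomial σ K))) := by
    rw [hIG, variableIdeal, Ideal.span_mul_span']
  have hGL : ∀ f ∈ G, ∀ j ∈ F, f * X j ∈ I * variableIdeal K F := fun f hf j hj =>
    Ideal.mul_mem_mul (hGI f hf) (X_mem_variableIdeal hj)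
  -- Linearity gives `a φ(f x_j) = f φ(a x_j)`, so modulo `P_F` the ratio `φ(f x_j) / f` is
  -- independent of the generator `f`. It maps `I` into itself since the values of `φ` lie in `I`.
  have hq : ∀ j ∈ F, ∃ q, ∀ f ∈ G, ∃ g, (f * X j, g) ∈ N ∧ zeroVars K F g = f * q := by
    intro j hj
    by_cases hG0 : ∃ a ∈ G, a ≠ 0
    · obtain ⟨a, haG, ha⟩ := hG0
      obtain ⟨v, hv⟩ := hN _ (hGL a haG j hj)
      have hcomm : ∀ f ∈ G, ∀ g, (f * X j, g) ∈ N → a * zeroVars K F g = f * zeroVars K F v := by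
        intro f hf g hg
        have h1 := hN0 (a * g - f * v) (by
          have h0 := N.sub_sub_mem (N.mul_mul_mem a hg) (N.mul_mul_mem f hv)
          rwa [mul_left_comm f a, sub_self] at h0)
        have h2 := mem_variableIdeal_iff.1 (Ideal.mul_le_right h1)
        rwa [map_sub, map_mul, map_mul, hGF a haG, hGF f hf, sub_eq_zero] at h2
      have hdvd : a ∣ zeroVars K F v := by
        refine dvd_of_forall_mem_ideal (I := I) ?_ ha ?_
        · exact fun h => ha (by simpa [h] using hGI a haG)
        · intro f hf
          rw [hIG] at hf
          refine Submodule.span_induction ?_ ?_ ?_ ?_ hf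
          · intro g hg
            obtain ⟨w, hw⟩ := hN _ (hGL g hg j hj)
            exact ⟨_, hI.zeroVars_mem hAF (hNI _ (hGL g hg j hj) w hw), hcomm g hg w hw⟩
          · exact ⟨0, I.zero_mem, by simp⟩
          · rintro x y - - ⟨w, hw, h1⟩ ⟨w', hw', h2⟩
            exact ⟨w + w', I.add_mem hw hw', by rw [mul_add, h1, h2, add_mul]⟩
          · rintro c x - ⟨w, hw, h1⟩
            refine ⟨c * w, I.mul_mem_left c hw, ?_⟩
            rw [smul_eq_mul, mul_left_comm, h1, mul_assoc]
      obtain ⟨q, hq⟩ := hdvd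
      refine ⟨q, fun f hf => ?_⟩
      obtain ⟨g, hg⟩ := hN _ (hGL f hf j hj)
      refine ⟨g, hg, mul_left_cancel₀ ha ?_⟩
      rw [hcomm f hf g hg, hq]
      ring
    · push Not at hG0
      refine ⟨0, fun f hf => ⟨0, ?_, by simp⟩⟩
      rw [hG0 f hf, zero_mul]
      exact N.zero_mem
  choose! q hq using hq
  let D : Derivation K (MvPolynomial σ K) (MvPolynomial σ K) :=
    mkDerivation K fun i => if i ∈ F then q i else 0
  have hDX : ∀ j ∈ F, D (X j) = q j := by
    intro j hj
    simp [D, mkDerivation_X, hj]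
  have hDG : ∀ f ∈ G, D f = 0 := by
    intro f hf
    refine derivation_eqOn_supported (D₂ := 0) ?_ (hG hf)
    intro i hi
    simp [D, mkDerivation_X, hAF.notMem_of_mem_left hi]
  refine ⟨D, Derivation.sub_mem_of_mem_span le_rfl hLspan N hN0 D ?_⟩
  rintro _ ⟨f, hf, _, ⟨j, hj, rfl⟩, rfl⟩
  obtain ⟨g, hg, hgq⟩ := hq j hj f hf
  have hD : D (f * X j) = f * q j := by
    rw [D.leibniz, hDG f hf, hDX j hj, smul_zero, add_zero, smul_eq_mul]
  refine ⟨g, hg, ?_⟩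
  change g - D (f * X j) ∈ _
  rw [hD]
  -- The error lies in `I` by assumption and in `P_F` by the choice of `q`, hence in `I P_F`.
  refine hI.mem_mul_variableIdeal hAF
    (I.sub_mem (hNI _ (hGL f hf j hj) g hg) (I.mul_mem_right _ (hGI f hf))) ?_
  rw [mem_variableIdeal_iff, map_sub, map_mul, hGF f hf, sub_eq_zero]
  calc zeroVars K F g = zeroVars K F (zeroVars K F g) := (zeroVars_zeroVars F g).symm
    _ = f * zeroVars K F (q j) := by rw [hgq, map_mul, hGF f hf]

/-- If `I` is rigid, then every homomorphism `I P_F → S/(I P_F)` is, modulo `I`, induced by a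
derivation. -/
theorem exists_derivation_modulo (hI : IsGeneratedIn A I) (hAF : Disjoint A F)
    (hF : F.Nontrivial) (h : IsRigidIdeal K I)
    (N : Submodule (MvPolynomial σ K) (MvPolynomial σ K × MvPolynomial σ K))
    (hN : ∀ f ∈ I * variableIdeal K F, ∃ g, (f, g) ∈ N)
    (hN0 : ∀ g, (0, g) ∈ N → g ∈ I) :
    ∃ D : Derivation K (MvPolynomial σ K) (MvPolynomial σ K),
      ∀ f ∈ I * variableIdeal K F, ∀ g, (f, g) ∈ N → g - D f ∈ I := by
  obtain ⟨i, hi, j, hj, hij⟩ := hF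
  have hiA := hAF.notMem_of_mem_right hi
  have hjA := hAF.notMem_of_mem_right hj
  have hL : ∀ f ∈ I, ∀ p ∈ variableIdeal K F, p * f ∈ I * variableIdeal K F := fun f hf p hp =>
    mul_comm f p ▸ Ideal.mul_mem_mul hf hp
  have huniq : ∀ f g g', (f, g) ∈ N → (f, g') ∈ N → g - g' ∈ I := fun f g g' hg hg' =>
    hN0 _ (sub_self f ▸ N.sub_sub_mem hg hg')
  -- The extension of `φ` modulo `I` to a homomorphism `I → S/I`: pairs `(f, w)` with `φ(p f) = p w`
  -- modulo `I` for all `p ∈ P_F`.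
  let M : Submodule (MvPolynomial σ K) (MvPolynomial σ K × MvPolynomial σ K) :=
    { carrier := {x | ∀ p ∈ variableIdeal K F, ∃ g, (p * x.1, g) ∈ N ∧ g - p * x.2 ∈ I}
      zero_mem' := fun p _ => ⟨0, (mul_zero p).symm ▸ N.zero_mem, by simp⟩
      add_mem' := by
        intro x y hx hy p hp
        obtain ⟨g, hg, h1⟩ := hx p hp
        obtain ⟨g', hg', h2⟩ := hy p hp
        refine ⟨g + g', ?_, ?_⟩
        · rw [Prod.fst_add, mul_add]
          exact N.add_mem hg hg'
        · rw [Prod.snd_add, mul_add, add_sub_add_comm]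
          exact I.add_mem h1 h2
      smul_mem' := by
        intro c x hx p hp
        obtain ⟨g, hg, h1⟩ := hx p hp
        refine ⟨c * g, ?_, ?_⟩
        · rw [Prod.smul_fst, smul_eq_mul, mul_left_comm]
          exact N.mul_mul_mem c hg
        · rw [Prod.smul_snd, smul_eq_mul, mul_left_comm, ← mul_sub]
          exact I.mul_mem_left c h1 }
  have hM : ∀ f w, (f, w) ∈ M ↔
      ∀ p ∈ variableIdeal K F, ∃ g, (p * f, g) ∈ N ∧ g - p * w ∈ I := fun f w => Iff.rfl
  have hMex : ∀ f ∈ I, ∃ w, (f, w) ∈ M := by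
    intro f hf
    obtain ⟨u, hu⟩ := hN _ (hL f hf _ (X_mem_variableIdeal hi))
    obtain ⟨v, hv⟩ := hN _ (hL f hf _ (X_mem_variableIdeal hj))
    have h1 : X j * u - X i * v ∈ I := huniq (X j * (X i * f)) _ _ (N.mul_mul_mem (X j) hu)
      (by rw [mul_left_comm]; exact N.mul_mul_mem (X i) hv)
    -- From `x_j φ(x_i f) = x_i φ(x_j f)` it follows that `x_i` divides `φ(x_i f)` modulo `I`; the
    -- quotient `w` is the value at `f`.
    obtain ⟨w, hw⟩ := hI.exists_sub_mul_mem hjA hiA hij.symm h1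
    refine ⟨w, (hM f w).2 fun p hp => ?_⟩
    obtain ⟨g, hg⟩ := hN _ (hL f hf p hp)
    refine ⟨g, hg, hI.mem_of_X_mul_mem hiA ?_⟩
    have h2 : X i * g - p * u ∈ I := huniq (X i * (p * f)) _ _ (N.mul_mul_mem (X i) hg)
      (by rw [mul_left_comm]; exact N.mul_mul_mem p hu)
    convert I.add_mem h2 (I.mul_mem_left p hw) using 1
    ring
  have hM0 : ∀ w, (0, w) ∈ M → w ∈ I := by
    intro w hw
    obtain ⟨g, hg, h1⟩ := (hM 0 w).1 hw _ (X_mem_variableIdeal hi)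
    rw [mul_zero] at hg
    exact hI.mem_of_X_mul_mem hiA (by simpa using I.sub_mem (hN0 g hg) h1)
  obtain ⟨D, hD⟩ := h.exists_derivation M hMex hM0
  refine ⟨D, Derivation.sub_mem_of_mem_span Ideal.mul_le_left
    (T := (I : Set (MvPolynomial σ K)) * (variableIdeal K F : Set (MvPolynomial σ K)))
    ?_ N hN0 D ?_⟩
  · rw [← Ideal.span_mul_span', Ideal.span_eq, Ideal.span_eq]
  · rintro _ ⟨f, hf, p, hp, rfl⟩
    obtain ⟨w, hw⟩ := hMex f hf
    obtain ⟨g, hg, h1⟩ := (hM f w).1 hw p hp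
    refine ⟨g, ?_, ?_⟩
    · change (f * p, g) ∈ N
      rwa [mul_comm]
    · convert I.sub_mem (I.add_mem h1 (I.mul_mem_left p (hD f hf w hw)))
        (I.mul_mem_right (D p) hf) using 1
      change g - D (f * p) = _
      rw [D.leibniz, smul_eq_mul, smul_eq_mul]
      ring

theorem isRigidIdeal_mul [Finite σ] (hI : IsGeneratedIn A I) (hAF : Disjoint A F)
    (hF : F.Nontrivial) (h : IsRigidIdeal K I) : IsRigidIdeal K (I * variableIdeal K F) := by
  refine isRigidIdeal_of_exists_derivation fun N hN hN0 => ?_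
  set L := I * variableIdeal K F with hL
  obtain ⟨D, hD⟩ := hI.exists_derivation_modulo hAF hF h N hN fun g hg =>
    Ideal.mul_le_left (hN0 g hg)
  -- The homomorphism `φ - D` on `I P_F`, whose values lie in `I` by the choice of `D`.
  let N' : Submodule (MvPolynomial σ K) (MvPolynomial σ K × MvPolynomial σ K) :=
    { carrier := {x | x.1 ∈ L ∧ ∃ g, (x.1, g) ∈ N ∧ g - D x.1 - x.2 ∈ L}
      zero_mem' := ⟨L.zero_mem, 0, N.zero_mem, by simp⟩
      add_mem' := by
        rintro x y ⟨hx, g, hg, h1⟩ ⟨hy, g', hg', h2⟩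
        refine ⟨L.add_mem hx hy, g + g', N.add_mem hg hg', ?_⟩
        convert L.add_mem h1 h2 using 1
        rw [Prod.fst_add, Prod.snd_add, map_add]
        ring
      smul_mem' := by
        rintro c x ⟨hx, g, hg, h1⟩
        refine ⟨L.mul_mem_left c hx, c * g, N.mul_mul_mem c hg, ?_⟩
        convert L.sub_mem (L.mul_mem_left c h1) (L.mul_mem_right (D c) hx) using 1
        rw [Prod.smul_fst, Prod.smul_snd, smul_eq_mul, smul_eq_mul, D.leibniz, smul_eq_mul,
          smul_eq_mul]
        ring }
  have hN' : ∀ f g, (f, g) ∈ N' ↔ f ∈ L ∧ ∃ g', (f, g') ∈ N ∧ g' - D f - g ∈ L :=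
    fun f g => Iff.rfl
  have hN'ex : ∀ f ∈ L, ∃ g, (f, g) ∈ N' := by
    intro f hf
    obtain ⟨g, hg⟩ := hN f hf
    exact ⟨g - D f, (hN' _ _).2 ⟨hf, g, hg, by simp⟩⟩
  have hN'0 : ∀ g, (0, g) ∈ N' → g ∈ L := by
    intro g hg
    obtain ⟨-, g', hg', h1⟩ := (hN' _ _).1 hg
    rw [map_zero, sub_zero] at h1
    exact (L.sub_mem_iff_right (hN0 g' hg')).1 h1
  have hN'I : ∀ f ∈ L, ∀ g, (f, g) ∈ N' → g ∈ I := by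
    intro f hf g hg
    obtain ⟨-, g', hg', h1⟩ := (hN' _ _).1 hg
    exact (I.sub_mem_iff_right (hD f hf g' hg')).1 (Ideal.mul_le_left h1)
  obtain ⟨D', hD'⟩ := hI.exists_derivation_of_image_le hAF N' hN'ex hN'0 hN'I
  refine ⟨D + D', fun f hf g hg => ?_⟩
  have h1 := hD' f hf (g - D f) ((hN' _ _).2 ⟨hf, g, hg, by simp⟩)
  rwa [sub_sub] at h1

end IsGeneratedIn

end MvPolynomial

/-! ### Products of variable ideals -/

namespace MvPolynomial

variable {K σ : Type*} [Field K]

open scoped Pointwise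

theorem isGeneratedIn_variableIdeal (F : Set σ) : IsGeneratedIn F (variableIdeal K F) :=
  ⟨X '' F, Algebra.subset_adjoin, rfl⟩

theorem IsGeneratedIn.mul {A B : Set σ} {I J : Ideal (MvPolynomial σ K)}
    (hI : IsGeneratedIn A I) (hJ : IsGeneratedIn B J) : IsGeneratedIn (A ∪ B) (I * J) := by
  obtain ⟨G, hG, rfl⟩ := hI
  obtain ⟨H, hH, rfl⟩ := hJ
  refine ⟨G * H, ?_, Ideal.span_mul_span' G H⟩
  rintro _ ⟨g, hg, h, hh, rfl⟩
  exact mul_mem (supported_mono Set.subset_union_left (hG hg))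
    (supported_mono Set.subset_union_right (hH hh))

theorem isGeneratedIn_prod {ι : Type*} (T : Finset ι) (F : ι → Set σ) :
    IsGeneratedIn (⋃ i ∈ T, F i) (∏ i ∈ T, variableIdeal K (F i)) := by
  classical
  induction T using Finset.induction_on with
  | empty => exact ⟨{1}, Set.singleton_subset_iff.2 (one_mem (supported K _)), by simp⟩
  | insert a T ha ih =>
    rw [Finset.prod_insert ha, Finset.set_biUnion_insert]
    exact (isGeneratedIn_variableIdeal (F a)).mul ih

theorem _root_.IsSquarefreeMonomialIdealIn.isGeneratedIn {A : Set σ}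
    {I : Ideal (MvPolynomial σ K)} (hI : IsSquarefreeMonomialIdealIn A I) :
    IsGeneratedIn A I := by
  obtain ⟨G, hG, rfl⟩ := hI
  refine ⟨_, ?_, rfl⟩
  rintro _ ⟨N, hN, rfl⟩
  exact prod_mem fun i hi => X_mem_supported.2 (hG N hN hi)

theorem isPrincipal_variableIdeal_iff {F : Set σ} :
    Submodule.IsPrincipal (variableIdeal K F) ↔ F.Subsingleton := by
  constructor
  · rintro ⟨p, hp⟩ i hi j hj
    by_contra hij
    have hdvd : ∀ k ∈ F, p ∣ X k := fun k hk => by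
      have := X_mem_variableIdeal (K := K) hk
      rw [hp] at this
      exact Ideal.mem_span_singleton.1 this
    have hu : ¬ IsUnit p := by
      intro hu
      have h1 : p ∈ variableIdeal K F := by
        rw [hp]
        exact Submodule.mem_span_singleton_self p
      have h2 := zeroVars_of_mem_variableIdeal h1
      -- `P_F` is proper: `zeroVars` kills it but maps units to units.
      exact (hu.map (zeroVars K F)).ne_zero h2
    have hass : ∀ k ∈ F, Associated p (X k) := fun k hk =>
      (X_prime.irreducible.dvd_iff.1 (hdvd k hk)).resolve_left hu |>.symm
    exact hij (by simpa using ((hass i hi).symm.trans (hass j hj)).dvd)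
  · intro h
    obtain rfl | ⟨i, rfl⟩ := h.eq_empty_or_singleton
    · rw [variableIdeal, Set.image_empty, Ideal.span_empty]
      infer_instance
    · rw [variableIdeal, Set.image_singleton]
      exact ⟨X i, rfl⟩

theorem IsGeneratedIn.isRigidIdeal_mul_iff [Finite σ] {A F : Set σ}
    {I : Ideal (MvPolynomial σ K)} (hI : IsGeneratedIn A I) (hAF : Disjoint A F)
    (hF : ¬ Submodule.IsPrincipal (variableIdeal K F)) :
    IsRigidIdeal K (I * variableIdeal K F) ↔ IsRigidIdeal K I := by
  rw [isPrincipal_variableIdeal_iff, Set.not_subsingleton_iff] at hF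
  exact ⟨hI.isRigidIdeal_of_mul hAF hF.nonempty, hI.isRigidIdeal_mul hAF hF⟩

theorem isRigidIdeal_top {S : Type*} [CommRing S] [Algebra K S] :
    IsRigidIdeal K (⊤ : Ideal S) :=
  isRigidIdeal_of_exists_derivation fun _ _ _ => ⟨0, fun _ _ _ _ => Submodule.mem_top⟩

theorem isRigidIdeal_variableIdeal_singleton (i : σ) :
    IsRigidIdeal K (variableIdeal K {i}) := by
  classical
  refine isRigidIdeal_of_exists_derivation fun N hN hN0 => ?_
  obtain ⟨g, hg⟩ := hN _ (X_mem_variableIdeal (Set.mem_singleton i))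
  refine ⟨mkDerivation K (Pi.single i g), Derivation.sub_mem_of_mem_span le_rfl rfl N hN0 _ ?_⟩
  rintro _ ⟨_, rfl, rfl⟩
  exact ⟨g, hg, by simp [mkDerivation_X]⟩

/-- The ideal is free on its generator `f`, so `f ↦ 1` is a homomorphism. As `f` lies in the square
of the maximal ideal at the origin, `1 - D f ∈ (f)` fails on evaluation there. -/
theorem not_isRigidIdeal_span_X_mul_X_mul (a b : σ) {h : MvPolynomial σ K} (hh : h ≠ 0) :
    ¬ IsRigidIdeal K (Ideal.span {X a * X b * h}) := by
  intro hr
  set f : MvPolynomial σ K := X a * X b * h with hf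
  have hf0 : f ≠ 0 := mul_ne_zero (mul_ne_zero (X_ne_zero a) (X_ne_zero b)) hh
  have hN : ∀ x ∈ Ideal.span {f}, ∃ g, (x, g) ∈ Submodule.span (MvPolynomial σ K)
      {((f, 1) : MvPolynomial σ K × MvPolynomial σ K)} := by
    intro x hx
    obtain ⟨c, rfl⟩ := Ideal.mem_span_singleton'.1 hx
    exact ⟨c, Submodule.mem_span_singleton.2 ⟨c, by simp⟩⟩
  obtain ⟨D, hD⟩ := hr.exists_derivation _ hN fun g hg => by
    obtain ⟨c, hc⟩ := Submodule.mem_span_singleton.1 hg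
    rw [Prod.smul_mk, Prod.mk.injEq, smul_eq_mul, smul_eq_mul, mul_one] at hc
    rw [← hc.2, (mul_eq_zero.1 hc.1).resolve_right hf0]
    exact Ideal.zero_mem _
  have h1 := hD f (Ideal.mem_span_singleton_self f) 1 (Submodule.mem_span_singleton_self _)
  obtain ⟨c, hc⟩ := Ideal.mem_span_singleton.1 h1
  have h2 := congrArg (eval (0 : σ → K)) hc
  simp [hf, D.leibniz] at h2

/-- A product of ideals generated by single variables is rigid if and only if it has at most one
factor. -/
theorem isRigidIdeal_prod_of_singletons {ι : Type*} (T : Finset ι) (F : ι → Set σ)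
    (hF : ∀ i ∈ T, ∃ a, F i = {a}) :
    IsRigidIdeal K (∏ i ∈ T, variableIdeal K (F i)) ↔ (T : Set ι).Subsingleton := by
  classical
  constructor
  · intro h i hi j hj
    by_contra hij
    obtain ⟨a, ha⟩ := hF i hi
    obtain ⟨b, hb⟩ := hF j hj
    have hrest : ∀ T' ⊆ T, ∃ h : MvPolynomial σ K, h ≠ 0 ∧
        ∏ k ∈ T', variableIdeal K (F k) = Ideal.span {h} := by
      intro T' hT'
      have : Nonempty σ := ⟨a⟩
      choose! c hc using hF
      refine ⟨∏ k ∈ T', X (c k), Finset.prod_ne_zero_iff.2 fun k _ => X_ne_zero _, ?_⟩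
      rw [← Ideal.prod_span_singleton]
      refine Finset.prod_congr rfl fun k hk => ?_
      rw [hc k (hT' hk), variableIdeal, Set.image_singleton]
    obtain ⟨p, hp, hprod⟩ := hrest ((T.erase i).erase j)
      ((Finset.erase_subset _ _).trans (Finset.erase_subset _ _))
    rw [← Finset.mul_prod_erase T _ hi,
      ← Finset.mul_prod_erase (T.erase i) _ (Finset.mem_erase.2 ⟨Ne.symm hij, hj⟩), hprod, ha, hb,
      variableIdeal, variableIdeal, Set.image_singleton, Set.image_singleton,
      Ideal.span_singleton_mul_span_singleton, Ideal.span_singleton_mul_span_singleton,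
      ← mul_assoc] at h
    exact not_isRigidIdeal_span_X_mul_X_mul a b hp h
  · intro h
    obtain h | ⟨i, h⟩ := h.eq_empty_or_singleton
    · rw [Finset.coe_eq_empty] at h
      rw [h, Finset.prod_empty, Ideal.one_eq_top]
      exact isRigidIdeal_top
    · rw [Finset.coe_eq_singleton] at h
      subst h
      obtain ⟨a, ha⟩ := hF i (Finset.mem_singleton_self i)
      rw [Finset.prod_singleton, ha]
      exact isRigidIdeal_variableIdeal_singleton a

/-- Factors that are not principal do not affect the rigidity of a product of ideals generated by
pairwise disjoint sets of variables. -/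
theorem isRigidIdeal_prod_union_iff [Finite σ] {ι : Type*} [DecidableEq ι] {F : ι → Set σ}
    (hF : Pairwise fun i j => Disjoint (F i) (F j)) (Q T : Finset ι) (hQT : Disjoint Q T)
    (hT : ∀ i ∈ T, ¬ Submodule.IsPrincipal (variableIdeal K (F i))) :
    IsRigidIdeal K (∏ i ∈ Q ∪ T, variableIdeal K (F i)) ↔
      IsRigidIdeal K (∏ i ∈ Q, variableIdeal K (F i)) := by
  induction T using Finset.induction_on with
  | empty => rw [Finset.union_empty]
  | insert a T ha ih =>
    rw [Finset.disjoint_insert_right] at hQT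
    have haQT : a ∉ Q ∪ T := by simp [ha, hQT.1]
    rw [← ih hQT.2 fun i hi => hT i (Finset.mem_insert_of_mem hi), Finset.union_insert,
      Finset.prod_insert haQT, mul_comm]
    refine (isGeneratedIn_prod (Q ∪ T) F).isRigidIdeal_mul_iff ?_
      (hT a (Finset.mem_insert_self a T))
    simp only [Set.disjoint_iUnion_left]
    rintro i hi
    exact hF fun h => haQT (h ▸ hi)

end MvPolynomial

/-! ### The main theorem -/

theorem mainTheorem12 {K σ : Type*} [Field K] [Finite σ] :
    (∀ (A F : Set σ) (I : Ideal (MvPolynomial σ K)),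
      Disjoint A F →
      IsSquarefreeMonomialIdealIn A I →
      ¬ Submodule.IsPrincipal (variableIdeal K F) →
      (IsRigidIdeal K (I * variableIdeal K F) ↔ IsRigidIdeal K I)) ∧
    (∀ (t : ℕ) (F : Fin t → Set σ),
      (∀ i, (F i).Nonempty) →
      Pairwise (fun i j => Disjoint (F i) (F j)) →
      (IsRigidIdeal K (∏ i, variableIdeal K (F i)) ↔
        {i | Submodule.IsPrincipal (variableIdeal K (F i))}.Subsingleton)) := by
  classical
  refine ⟨fun A F I hAF hI hF => hI.isGeneratedIn.isRigidIdeal_mul_iff hAF hF, ?_⟩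
  intro t F hne hdisj
  -- The principal factors; since each `F i` is nonempty, these are generated by single variables.
  let Q : Finset (Fin t) := {i | Submodule.IsPrincipal (variableIdeal K (F i))}
  have hunion : Finset.univ = Q ∪ Qᶜ := (Finset.union_compl Q).symm
  rw [hunion, MvPolynomial.isRigidIdeal_prod_union_iff hdisj Q Qᶜ disjoint_compl_right
    (by simp [Q]), MvPolynomial.isRigidIdeal_prod_of_singletons]
  · simp [Q]
  · intro i hi
    have hp : Submodule.IsPrincipal (variableIdeal K (F i)) := by simpa [Q] using hi
    exact Set.exists_eq_singleton_iff_nonempty_subsingleton.2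
      ⟨hne i, MvPolynomial.isPrincipal_variableIdeal_iff.1 hp⟩
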